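/- Let $R$ be a commutative Noetherian ring, $I,J$ ideals of $R$, and $\mathcal S$ a Serre class of $R$-modules (a class containing $0$ and closed under submodules, quotients and extensions). Let $W(I,J)$ be the set of primes $\mathfrak p$ of $R$ such that $I^n\subseteq\mathfrak p+J$ for some $n\ge 1$, and for an $R$-module $M$ let $\Gamma_{I,J}(M)=\{x\in M\mid \operatorname{Supp}(Rx)\subseteq W(I,J)\}$. Let $H^i_{I,J}$ be the $i$-th right derived functor of $\Gamma_{I,J}$, and put $$\mathrm{cd}_{\mathcal S}(I,J,M)=\sup\{i\in\mathbb N_0\mid H^i_{I,J}(M)\notin\mathcal S\}\in\mathbb N_0\cup\{\infty\},$$ where the supremum of the empty set is $0$ and that of an unbounded set is $\infty$. Then for every finitely generated $R$-module $M$ we have $$\begin{aligned} \mathrm{cd}_{\mathcal S}(I,J,M)&=\max\{\mathrm{cd}_{\mathcal S}(I,J,R/\mathfrak p)\mid \mathfrak p\in\operatorname{Ass}(M)\}\\ &=\max\{\mathrm{cd}_{\mathcal S}(I,J,R/\mathfrak p)\mid \mathfrak p\in\operatorname{Min}\operatorname{Ass}(M)\}\\ &=\max\{\mathrm{cd}_{\mathcal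 S}(I,J,R/\mathfrak p)\mid \mathfrak p\in\operatorname{Supp}(M)\}\\ &=\max\{\mathrm{cd}_{\mathcal S}(I,J,R/\mathfrak p)\mid \mathfrak p\in\operatorname{Min}\operatorname{Supp}(M)\}\\ &=\max\{\mathrm{cd}_{\mathcal S}(I,J,N)\mid N\text{ a finitely generated submodule of }M\}\\ &=\max\{i\ge 0\mid H^i_{I,J}(R/\mathfrak p)\notin\mathcal S\text{ for some }\mathfrak p\in\operatorname{Ass}(M)\}\\ &=\min\{n\ge 0\mid H^i_{I,J}(R/\mathfrak p)\in\mathcal S\text{ for all }i>n\text{ and all }\mathfrak p\in\operatorname{Ass}(M)\}. \end{aligned}$$ Here $\operatorname{Min}\operatorname{Ass}(M)$ and $\operatorname{Min}\operatorname{Supp}(M)$ are the sets of minimal elements of $\operatorname{Ass}(M)$ and $\operatorname{Supp}(M)$ under inclusion. Each maximum over a non-empty set is attained, and the maximum of the empty set is read as $0$. -/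

import Mathlib

open CategoryTheory

universe u

namespace PairLocalCohomology

/-- `W(I, J)`: the primes `𝔭` of `R` with `I ^ n ⊆ 𝔭 + J` for some `n ≥ 1`. -/
def W {R : Type u} [CommRing R] (I J : Ideal R) : Set (PrimeSpectrum R) :=
  {p | ∃ n : ℕ, 1 ≤ n ∧ I ^ n ≤ p.asIdeal ⊔ J}

section Torsion

variable {R : Type u} [CommRing R]

/-- `Supp (R x)` is the set of primes containing the annihilator of `x`. -/
theorem mem_support_span_singleton {M : Type u} [AddCommGroup M] [Module R M] (x : M)
    (p : PrimeSpectrum R) :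
    p ∈ Module.support R (Submodule.span R {x}) ↔
      ∀ r : R, r • x = 0 → r ∈ p.asIdeal := by
  rw [Module.mem_support_iff_of_finite, SetLike.le_def]
  refine forall_congr' fun r => ?_
  rw [Submodule.mem_annihilator_span_singleton]

/-- The `(I, J)`-torsion submodule `Γ_{I,J}(M)`: all `x ∈ M` with `Supp (R x) ⊆ W(I, J)`. -/
def torsion (I J : Ideal R) (M : Type u) [AddCommGroup M] [Module R M] : Submodule R M where
  carrier := {x | Module.support R (Submodule.span R {x}) ⊆ W I J}
  zero_mem' := by
    intro p hp
    rw [mem_support_span_singleton] at hp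
    exact absurd ((Ideal.eq_top_iff_one _).2 (hp 1 (smul_zero 1))) p.2.ne_top
  add_mem' := by
    intro x y hx hy p hp
    rw [mem_support_span_singleton] at hp
    by_cases h : ∀ r : R, r • x = 0 → r ∈ p.asIdeal
    · exact hx ((mem_support_span_singleton x p).2 h)
    · push Not at h
      obtain ⟨a, hax, hap⟩ := h
      refine hy ((mem_support_span_singleton y p).2 fun b hby => ?_)
      have hab : (a * b) • (x + y) = 0 := by
        rw [smul_add, mul_smul a b y, hby, smul_zero, mul_comm, mul_smul, hax, smul_zero, add_zero]
      exact (p.2.mem_or_mem (hp _ hab)).resolve_left hap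
  smul_mem' := by
    intro c x hx p hp
    rw [mem_support_span_singleton] at hp
    refine hx ((mem_support_span_singleton x p).2 fun r hr => hp r ?_)
    rw [smul_comm, hr, smul_zero]

theorem map_mem_torsion (I J : Ideal R) {M N : Type u} [AddCommGroup M] [Module R M]
    [AddCommGroup N] [Module R N] (f : M →ₗ[R] N) (x : M) (hx : x ∈ torsion I J M) :
    f x ∈ torsion I J N := by
  intro p hp
  rw [mem_support_span_singleton] at hp
  refine hx ((mem_support_span_singleton x p).2 fun r hr => hp r ?_)
  rw [← map_smul, hr, map_zero]

/-- The functor `Γ_{I,J}` on `R`-modules; on morphisms it is restriction. -/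
def torsionFunctor (I J : Ideal R) : ModuleCat.{u} R ⥤ ModuleCat.{u} R where
  obj M := ModuleCat.of R (torsion I J M)
  map {_ _} f := ModuleCat.ofHom (f.hom.restrict (map_mem_torsion I J f.hom))

instance (I J : Ideal R) : (torsionFunctor I J).Additive where

/-- The local cohomology module `H^i_{I,J}(M)`: the value at `M` of the `i`-th right derived
functor of `Γ_{I,J}`. -/
noncomputable def localCohomology (I J : Ideal R) (i : ℕ) (M : Type u) [AddCommGroup M]
    [Module R M] : ModuleCat.{u} R :=
  ((torsionFunctor I J).rightDerived i).obj (ModuleCat.of R M)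

/-- The Serre cohomological dimension `cd_𝒮(I, J, M)`: the supremum, in `{0, 1, 2, …, ∞}`, of the
`i` with `H^i_{I,J}(M) ∉ 𝒮`. It is `∞` if these `i` are unbounded, and `0` if there are none. -/
noncomputable def serreCD (S : ObjectProperty (ModuleCat.{u} R)) (I J : Ideal R) (M : Type u)
    [AddCommGroup M] [Module R M] : ℕ∞ :=
  sSup {k : ℕ∞ | ∃ i : ℕ, k = i ∧ ¬ S (localCohomology I J i M)}

end Torsion

/-- `a = max A` in `{0, 1, 2, …, ∞}`, where the maximum of the empty set is `0`: `a` is the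
supremum of `A`, and it is attained if `A` is non-empty. -/
def IsMaxOrZero (A : Set ℕ∞) (a : ℕ∞) : Prop :=
  IsLUB A a ∧ (A.Nonempty → a ∈ A)

end PairLocalCohomology

/-!
# Serre cohomological dimension depends only on the support

All equalities follow from two facts about finitely generated modules `M`.

* `serreCD_mono`: `Supp N ⊆ Supp M` implies `cd N ≤ cd M`.
* `serreCD_le_of_primes`: `cd M ≤ t` as soon as `cd (R ⧸ 𝔭) ≤ t` for all `𝔭` minimal over `Ann M`.
  This follows from monotonicity by means of a prime filtration of `M`.

Monotonicity (`prop_localCohomology_of_support_subset`) is a descending induction on the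
cohomological degree. By prime filtrations it suffices to treat `R ⧸ 𝔭` with `𝔭 ∈ Supp M`, and here
Noetherian induction on `𝔭` applies. As `𝔭 ∈ Supp M`, there is a non-zero map `θ : M → R ⧸ 𝔭`. The
cohomology of its image is controlled by `Hⁱ(M)` and `Hⁱ⁺¹(ker θ)`, the latter by the induction on
the degree, while the cokernel of `θ` is filtered by primes strictly larger than `𝔭`.

The descending induction needs a degree above which all `Hⁱ_{I,J}` vanish, which is
`exists_forall_isZero_localCohomology`. It is proved by induction on the number of generators of `I`,
since `Γ_{I + K, J} = Γ_{I, J} ∩ Γ_{K, J}`. For a principal ideal, `Γ_{(a), J}` is the torsion with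
respect to the multiplicative set of all `aⁿ + j`, `j ∈ J`. It preserves injectivity by the
Artin-Rees lemma, and on a module on which all `aⁿ + j` act bijectively the functors
`Hⁱ_{I + (a), J}` vanish for `i ≥ 1`, so that adding the generator `a` costs one degree.

In place of a long exact sequence, the argument uses two consequences of it for a Serre class
(`prop_localCohomology_middle`, `prop_localCohomology_right`) in positive degrees. They are obtained
by dimension shifting along embeddings into injective modules.
-/

/-! ### Splicing injective resolutions and dimension shifting -/

namespace CategoryTheory.InjectiveResolution

open Limits

universe v w

section Splice

variable {C : Type w} [Category.{v} C] [Abelian C]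

/-- The augmentation `Z ⟶ I⁰` of an injective resolution, as a morphism of the category. -/
noncomputable def aug {Z : C} (I : InjectiveResolution Z) : Z ⟶ I.cocomplex.X 0 :=
  (CochainComplex.fromSingle₀Equiv _ _ I.ι).1

@[simp]
lemma aug_d {Z : C} (I : InjectiveResolution Z) : I.aug ≫ I.cocomplex.d 0 1 = 0 :=
  (CochainComplex.fromSingle₀Equiv _ _ I.ι).2

instance {Z : C} (I : InjectiveResolution Z) : Mono I.aug :=
  inferInstanceAs (Mono (I.ι.f 0))

lemma exact_aug_d {Z : C} (I : InjectiveResolution Z) :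
    (ShortComplex.mk I.aug (I.cocomplex.d 0 1) I.aug_d).Exact :=
  ShortComplex.exact_of_f_is_kernel _ I.isLimitKernelFork

/-- A cochain complex `K` concentrated in degrees `≥ 0` and exact in positive degrees is a
resolution of `Z` as soon as `Z` is the kernel of its first differential. -/
lemma quasiIso_fromSingle₀ {K : CochainComplex C ℕ} {Z : C} (η : Z ⟶ K.X 0)
    (w : η ≫ K.d 0 1 = 0) [Mono η] (h₀ : (ShortComplex.mk η (K.d 0 1) w).Exact)
    (h : ∀ n, K.ExactAt (n + 1)) :
    QuasiIso ((CochainComplex.fromSingle₀Equiv K Z).symm ⟨η, w⟩) := by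
  refine ⟨fun n => ?_⟩
  rcases n with _ | n
  · rw [CochainComplex.quasiIsoAt₀_iff, ShortComplex.quasiIso_iff_of_zeros]
    · refine (ShortComplex.exact_and_mono_f_iff_of_iso ?_).2 ⟨h₀, ‹Mono η›⟩
      refine ShortComplex.isoMk (Iso.refl _) (Iso.refl _) (Iso.refl _) ?_
        ((Category.id_comp _).trans (Category.comp_id _).symm)
      simp only [Iso.refl_hom]
      erw [Category.id_comp, Category.comp_id]
      exact (CochainComplex.fromSingle₀Equiv_symm_apply_f_zero _ _).symm
    · rfl
    · rfl
    · exact K.shape 0 0 (by simp)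
  · rw [quasiIsoAt_iff_exactAt]
    · exact h n
    · apply CochainComplex.exactAt_succ_single_obj

variable {S : ShortComplex C}

/-- Splicing: from a short exact sequence `0 ⟶ X₁ ⟶ X₂ ⟶ X₃ ⟶ 0` with `X₂` injective and an
injective resolution `I` of `X₃`, the injective resolution `X₂ ⟶ I⁰ ⟶ I¹ ⟶ ⋯` of `X₁`. -/
noncomputable def splice (hS : S.ShortExact) [Injective S.X₂] (I : InjectiveResolution S.X₃) :
    InjectiveResolution S.X₁ where
  cocomplex := CochainComplex.augment I.cocomplex (S.g ≫ I.aug) (by simp)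
  injective n := by
    cases n with
    | zero => assumption
    | succ n => exact I.injective n
  ι := (CochainComplex.fromSingle₀Equiv
      (CochainComplex.augment I.cocomplex (S.g ≫ I.aug) (by simp)) S.X₁).symm
    ⟨S.f, (by simp : S.f ≫ S.g ≫ I.aug = 0)⟩
  quasiIso := by
    have := hS.mono_f
    have := hS.epi_g
    refine @quasiIso_fromSingle₀ _ _ _ (CochainComplex.augment I.cocomplex (S.g ≫ I.aug) (by simp))
      S.X₁ S.f (by simp : S.f ≫ S.g ≫ I.aug = 0) hS.mono_f ?_ ?_
    · let φ : S ⟶ ShortComplex.mk S.f (S.g ≫ I.aug) (by simp) :=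
        { τ₁ := 𝟙 _, τ₂ := 𝟙 _, τ₃ := I.aug }
      have : Epi φ.τ₁ := inferInstanceAs (Epi (𝟙 _))
      have : IsIso φ.τ₂ := inferInstanceAs (IsIso (𝟙 _))
      have : Mono φ.τ₃ := inferInstanceAs (Mono I.aug)
      exact (ShortComplex.exact_iff_of_epi_of_isIso_of_mono φ).1 hS.exact
    · intro n
      rcases n with _ | n
      · rw [HomologicalComplex.exactAt_iff' _ 0 1 2 (by simp) (by simp)]
        let φ : ShortComplex.mk (S.g ≫ I.aug) (I.cocomplex.d 0 1) (by simp) ⟶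
            ShortComplex.mk I.aug (I.cocomplex.d 0 1) I.aug_d :=
          { τ₁ := S.g, τ₂ := 𝟙 _, τ₃ := 𝟙 _ }
        have : Epi φ.τ₁ := inferInstanceAs (Epi S.g)
        have : IsIso φ.τ₂ := inferInstanceAs (IsIso (𝟙 _))
        have : Mono φ.τ₃ := inferInstanceAs (Mono (𝟙 _))
        exact (ShortComplex.exact_iff_of_epi_of_isIso_of_mono φ).2 I.exact_aug_d
      · rw [HomologicalComplex.exactAt_iff' _ (n + 1) (n + 2) (n + 3) (by simp) (by simp)]
        exact I.exact_succ n

end Splice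
end CategoryTheory.InjectiveResolution

namespace CategoryTheory.Functor
universe v w v' w'
open Limits
variable {C : Type w} [Category.{v} C] [Abelian C] [EnoughInjectives C]
  {D : Type w'} [Category.{v'} D] [Abelian D]

/-- The right derived functors in positive degree, as the homology of an explicit three-term complex.
Indices are written as successors, so that splicing shifts this complex definitionally. -/
noncomputable def rightDerivedObjIso' (F : C ⥤ D) [F.Additive] {X : C}
    (I : InjectiveResolution X) (n : ℕ) :
    (F.rightDerived (n + 1)).obj X ≅ (ShortComplex.mk (F.map (I.cocomplex.d n (n+1)))
     (F.map (I.cocomplex.d (n+1) (n+2))) (by rw [← F.map_comp]; simp)).homology :=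
  I.isoRightDerivedObj F (n + 1) ≪≫
    ShortComplex.homologyMapIso (HomologicalComplex.isoSc' _ n (n+1) (n+2) (by simp) (by simp))

/-- Dimension shifting: `Hⁿ⁺²(X₁) ≅ Hⁿ⁺¹(X₃)` if `X₂` is injective. -/
noncomputable def rightDerivedDimShift (F : C ⥤ D) [F.Additive] {S : ShortComplex C}
    (hS : S.ShortExact) [Injective S.X₂] (n : ℕ) :
    (F.rightDerived (n + 2)).obj S.X₁ ≅ (F.rightDerived (n + 1)).obj S.X₃ :=
  let I := InjectiveResolution.of S.X₃
  rightDerivedObjIso' F (I.splice hS) (n + 1) ≪≫ (rightDerivedObjIso' F I n).symm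
end CategoryTheory.Functor

/-! ### Torsion and the connecting homomorphism -/

namespace PairLocalCohomology
variable {R : Type u} [CommRing R]

lemma mem_torsion_of_map_mem (I J : Ideal R) {M N : Type u} [AddCommGroup M] [Module R M]
    [AddCommGroup N] [Module R N] (f : M →ₗ[R] N) (hf : Function.Injective f) (x : M)
    (hx : f x ∈ torsion I J N) : x ∈ torsion I J M := by
  intro p hp
  rw [mem_support_span_singleton] at hp
  refine hx ((mem_support_span_singleton (f x) p).2 fun r hr => hp r (hf ?_))
  rw [map_smul, hr, map_zero]

variable {M E C : Type u} [AddCommGroup M] [Module R M] [AddCommGroup E] [Module R E]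
  [AddCommGroup C] [Module R C]

lemma shortExact_of_exact {f : M →ₗ[R] E} {g : E →ₗ[R] C} (hf : Function.Injective f)
    (hg : Function.Surjective g) (h : Function.Exact f g) :
    (ShortComplex.mk (ModuleCat.ofHom f) (ModuleCat.ofHom g)
      (by ext x; exact h.apply_apply_eq_zero x)).ShortExact := by
  exact ModuleCat.shortComplex_shortExact _ h hf hg

/-- `H¹(M)` is the cokernel of `Γ(E) → Γ(C)` for an embedding of `M` into an injective module `E` with
cokernel `C`; the map `q` is the connecting homomorphism. -/
lemma exists_connecting (I J : Ideal R) [Module.Injective R E]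
    {f : M →ₗ[R] E} {g : E →ₗ[R] C} (hf : Function.Injective f)
    (hg : Function.Surjective g) (h : Function.Exact f g) :
    ∃ q : torsion I J C →ₗ[R] localCohomology I J 1 M, Function.Surjective q ∧
      ∀ c, q c = 0 ↔ ∃ e ∈ torsion I J E, g e = c := by
  let S := ShortComplex.mk (ModuleCat.ofHom f) (ModuleCat.ofHom g)
      (by ext x; exact h.apply_apply_eq_zero x)
  have hS : S.ShortExact := shortExact_of_exact hf hg h
  have : Injective S.X₂ := Module.injective_object_of_injective_module R E
  let Q := InjectiveResolution.of S.X₃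
  let K : ShortComplex (ModuleCat.{u} R) := ShortComplex.mk
    ((torsionFunctor I J).map ((Q.splice hS).cocomplex.d 0 1))
    ((torsionFunctor I J).map ((Q.splice hS).cocomplex.d 1 2)) (by rw [← Functor.map_comp]; simp)
  let e : localCohomology I J 1 M ≅ K.homology :=
    (torsionFunctor I J).rightDerivedObjIso' (Q.splice hS) 0
  have haug : Function.Injective Q.aug := (ModuleCat.mono_iff_injective _).1 inferInstance
  have hdd : Q.aug ≫ Q.cocomplex.d 0 1 = 0 := Q.aug_d
  let a : torsion I J C →ₗ[R] LinearMap.ker K.g.hom :=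
    LinearMap.codRestrict (LinearMap.ker K.g.hom) ((torsionFunctor I J).map Q.aug).hom (fun c =>
      Subtype.ext (congr($hdd (c : C))))
  have ha : Function.Surjective a := by
    rintro ⟨⟨y, hy⟩, hy'⟩
    obtain ⟨c, hc⟩ := (ShortComplex.moduleCat_exact_iff _).1 Q.exact_aug_d y
      (congrArg Subtype.val hy')
    refine ⟨⟨c, mem_torsion_of_map_mem I J Q.aug.hom haug c ?_⟩, Subtype.ext (Subtype.ext hc)⟩
    erw [hc]; exact hy
  let q := (LinearMap.range K.moduleCatToCycles).mkQ ∘ₗ a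
  have hq : Function.Surjective q := (Submodule.mkQ_surjective _).comp ha
  let i := (K.moduleCatHomologyIso.symm ≪≫ e.symm).toLinearEquiv
  refine ⟨i.toLinearMap ∘ₗ q, i.surjective.comp hq, fun c => ?_⟩
  have h1 : (i.toLinearMap ∘ₗ q) c = 0 ↔ q c = 0 := i.map_eq_zero_iff
  rw [h1]
  have h2 : q c = 0 ↔ a c ∈ LinearMap.range K.moduleCatToCycles :=
    Submodule.Quotient.mk_eq_zero _
  rw [h2]
  constructor
  · rintro ⟨⟨x, hx⟩, hxc⟩
    exact ⟨x, hx, haug congr((($hxc).1).1)⟩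
  · rintro ⟨x, hx, hxc⟩
    exact ⟨⟨x, hx⟩, Subtype.ext (Subtype.ext (congrArg Q.aug hxc))⟩

end PairLocalCohomology

/-! ### Serre classes and local cohomology of short exact sequences -/

namespace PairLocalCohomology
variable {R : Type u} [CommRing R]

section SerreClass

variable (P : ObjectProperty (ModuleCat.{u} R)) [P.IsSerreClass]

lemma prop_middle_of_exact {X Y Z : ModuleCat.{u} R} (f : X →ₗ[R] Y) (g : Y →ₗ[R] Z)
    (h : Function.Exact f g) (hX : P X) (hZ : P Z) : P Y :=
  P.prop_X₂_of_exact (S := ShortComplex.mk (ModuleCat.ofHom f) (ModuleCat.ofHom g)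
      (by ext x; exact h.apply_apply_eq_zero x))
    ((ShortComplex.moduleCat_exact_iff _).2 fun y hy => (h y).1 hy) hX hZ

/-- Exactness passes to compatible quotients: three quotients `HX`, `HY`, `HZ` of the terms of
`X → Y → Z`, such that `HX → HY → HZ` is well defined and exact. -/
lemma prop_middle_of_quotients {X Y Z : Type u} [AddCommGroup X] [Module R X] [AddCommGroup Y]
    [Module R Y] [AddCommGroup Z] [Module R Z] {HX HY HZ : ModuleCat.{u} R}
    (qX : X →ₗ[R] HX) (qY : Y →ₗ[R] HY) (qZ : Z →ₗ[R] HZ)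
    (hqX : Function.Surjective qX) (hqY : Function.Surjective qY)
    (α : X →ₗ[R] Y) (β : Y →ₗ[R] Z)
    (hα : ∀ x, qX x = 0 → qY (α x) = 0) (hβ : ∀ y, qY y = 0 → qZ (β y) = 0)
    (h₀ : ∀ x, β (α x) = 0) (h : ∀ y, qZ (β y) = 0 → ∃ x, qY (α x) = qY y)
    (hX : P HX) (hZ : P HZ) : P HY := by
  let eX := qX.quotKerEquivOfSurjective hqX
  let eY := qY.quotKerEquivOfSurjective hqY
  let f : HX →ₗ[R] HY := (LinearMap.ker qX).liftQ (qY ∘ₗ α) (fun x hx => hα x hx) ∘ₗ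
    eX.symm.toLinearMap
  let g : HY →ₗ[R] HZ := (LinearMap.ker qY).liftQ (qZ ∘ₗ β) (fun x hx => hβ x hx) ∘ₗ
    eY.symm.toLinearMap
  have heX : ∀ x, eX.symm (qX x) = Submodule.Quotient.mk x := fun x =>
    eX.symm_apply_eq.2 rfl
  have heY : ∀ x, eY.symm (qY x) = Submodule.Quotient.mk x := fun x =>
    eY.symm_apply_eq.2 rfl
  have hf : ∀ x, f (qX x) = qY (α x) := fun x => by
    simp only [f, LinearMap.comp_apply, LinearEquiv.coe_coe, heX]; rfl
  have hg : ∀ y, g (qY y) = qZ (β y) := fun y => by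
    simp only [g, LinearMap.comp_apply, LinearEquiv.coe_coe, heY]; rfl
  refine prop_middle_of_exact P f g (fun y => ?_) hX hZ
  obtain ⟨y, rfl⟩ := hqY y
  rw [hg]
  constructor
  · intro hy
    obtain ⟨x, hx⟩ := h y hy
    exact ⟨qX x, (hf x).trans hx⟩
  · rintro ⟨x, hx⟩
    obtain ⟨x, rfl⟩ := hqX x
    rw [← hg, ← hx, hf, hg, h₀, map_zero]

end SerreClass

instance injective_prod (E E' : Type u) [AddCommGroup E] [Module R E] [AddCommGroup E'] [Module R E']
    [Module.Injective R E] [Module.Injective R E'] : Module.Injective R (E × E') where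
  out X Y _ _ _ _ i hi f := by
    obtain ⟨a, ha⟩ := Module.Injective.out i hi (LinearMap.fst R E E' ∘ₗ f)
    obtain ⟨b, hb⟩ := Module.Injective.out i hi (LinearMap.snd R E E' ∘ₗ f)
    exact ⟨a.prod b, fun x => Prod.ext (ha x) (hb x)⟩

lemma exists_injective_embedding (M : Type u) [AddCommGroup M] [Module R M] :
    ∃ (E : ModuleCat.{u} R) (f : M →ₗ[R] E), Module.Injective R E ∧ Function.Injective f := by
  let E : ModuleCat.{u} R := Injective.under (ModuleCat.of R M)
  have : Injective (ModuleCat.of R E) := Injective.injective_under (ModuleCat.of R M)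
  exact ⟨E, (Injective.ι (ModuleCat.of R M)).hom,
    Module.injective_module_of_injective_object R E,
    (ModuleCat.mono_iff_injective (Injective.ι (ModuleCat.of R M))).1 inferInstance⟩

section LocalCohomology

variable (P : ObjectProperty (ModuleCat.{u} R)) [P.IsSerreClass] (I J : Ideal R)

/-- Isomorphic modules have isomorphic local cohomology. -/
noncomputable def localCohomologyCongr {M N : Type u} [AddCommGroup M] [Module R M] [AddCommGroup N]
    [Module R N] (e : M ≃ₗ[R] N) (i : ℕ) :
    localCohomology I J i M ≅ localCohomology I J i N :=
  ((torsionFunctor I J).rightDerived i).mapIso e.toModuleIso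

variable {M E C : Type u} [AddCommGroup M] [Module R M] [AddCommGroup E] [Module R E]
  [AddCommGroup C] [Module R C]

lemma prop_localCohomology_shift_iff [Module.Injective R E] {f : M →ₗ[R] E} {g : E →ₗ[R] C}
    (hf : Function.Injective f) (hg : Function.Surjective g) (h : Function.Exact f g) (n : ℕ) :
    P (localCohomology I J (n + 2) M) ↔ P (localCohomology I J (n + 1) C) := by
  have : Injective (ShortComplex.mk (ModuleCat.ofHom f) (ModuleCat.ofHom g)
      (by ext x; exact h.apply_apply_eq_zero x)).X₂ :=
    Module.injective_object_of_injective_module R E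
  exact P.prop_iff_of_iso
    ((torsionFunctor I J).rightDerivedDimShift (shortExact_of_exact hf hg h) n)

lemma prop_localCohomology_injective (E : Type u) [AddCommGroup E] [Module R E]
    [Module.Injective R E] (n : ℕ) : P (localCohomology I J (n + 1) E) := by
  have : Injective (ModuleCat.of R E) := Module.injective_object_of_injective_module R E
  exact P.prop_of_isZero ((torsionFunctor I J).isZero_rightDerived_obj_injective_succ n _)

lemma isZero_localCohomology_one_iff [Module.Injective R E] {f : M →ₗ[R] E} {g : E →ₗ[R] C}
    (hf : Function.Injective f) (hg : Function.Surjective g) (h : Function.Exact f g) :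
    Limits.IsZero (localCohomology I J 1 M) ↔ ∀ c ∈ torsion I J C, ∃ e ∈ torsion I J E, g e = c := by
  obtain ⟨q, hq, hq'⟩ := exists_connecting I J hf hg h
  rw [ModuleCat.isZero_iff_subsingleton]
  constructor
  · intro hz c hc
    exact (hq' ⟨c, hc⟩).1 (Subsingleton.elim _ _)
  · intro hc
    refine subsingleton_of_forall_eq 0 fun y => ?_
    obtain ⟨c, rfl⟩ := hq y
    exact (hq' c).2 (hc c c.2)

/-- Local cohomology is half exact in positive degrees. The short exact sequence embeds into the split
sequence `0 → EA → EA × EC → EC → 0` of injective modules, and one passes to the cokernels; this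
lowers the degree until `H¹` is reached, which is a cokernel by `exists_connecting`. -/
theorem prop_localCohomology_middle (n : ℕ) {A B C : Type u} [AddCommGroup A] [Module R A]
    [AddCommGroup B] [Module R B] [AddCommGroup C] [Module R C] {f : A →ₗ[R] B} {g : B →ₗ[R] C}
    (hf : Function.Injective f) (hg : Function.Surjective g) (h : Function.Exact f g)
    (hA : P (localCohomology I J (n + 1) A)) (hC : P (localCohomology I J (n + 1) C)) :
    P (localCohomology I J (n + 1) B) := by
  induction n using Nat.strong_induction_on generalizing A B C with
  | _ n ih =>
  obtain ⟨EA, a, _, ha⟩ := exists_injective_embedding (R := R) A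
  obtain ⟨EC, c, _, hc⟩ := exists_injective_embedding (R := R) C
  obtain ⟨β, hβ⟩ := Module.Injective.out f hf a
  -- `b` is the middle column of the diagram with exact rows and injective columns `a`, `b`, `c`.
  let b : B →ₗ[R] EA × EC := β.prod (c ∘ₗ g)
  have hb : Function.Injective b := by
    rw [injective_iff_map_eq_zero]
    intro x hx
    obtain ⟨y, rfl⟩ := (h x).1 (hc ((congrArg Prod.snd hx).trans (map_zero c).symm))
    have : a y = 0 := (hβ y).symm.trans (congrArg Prod.fst hx)
    rw [ha (this.trans (map_zero a).symm), map_zero]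
  let f' : (EA ⧸ LinearMap.range a) →ₗ[R] ((EA × EC) ⧸ LinearMap.range b) :=
    Submodule.mapQ _ _ (LinearMap.inl R EA EC) (by
      rintro _ ⟨x, rfl⟩
      exact ⟨f x, Prod.ext (hβ x) (by simp [b, h.apply_apply_eq_zero])⟩)
  let g' : ((EA × EC) ⧸ LinearMap.range b) →ₗ[R] (EC ⧸ LinearMap.range c) :=
    Submodule.mapQ _ _ (LinearMap.snd R EA EC) (by
      rintro _ ⟨x, rfl⟩
      exact ⟨g x, rfl⟩)
  have hf' : Function.Injective f' := by
    rw [injective_iff_map_eq_zero]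
    intro x hx
    obtain ⟨x, rfl⟩ := Submodule.Quotient.mk_surjective _ x
    obtain ⟨y, hy⟩ := (Submodule.Quotient.mk_eq_zero _).1 hx
    obtain ⟨z, rfl⟩ := (h y).1 (hc ((congrArg Prod.snd hy).trans (map_zero c).symm))
    exact (Submodule.Quotient.mk_eq_zero _).2 ⟨z, (hβ z).symm.trans (congrArg Prod.fst hy)⟩
  have hg' : Function.Surjective g' := by
    intro x
    obtain ⟨x, rfl⟩ := Submodule.Quotient.mk_surjective _ x
    exact ⟨Submodule.Quotient.mk (0, x), rfl⟩
  have h' : Function.Exact f' g' := by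
    intro y
    obtain ⟨⟨y, z⟩, rfl⟩ := Submodule.Quotient.mk_surjective _ y
    constructor
    · intro hy
      obtain ⟨t, ht⟩ := (Submodule.Quotient.mk_eq_zero _).1 hy
      obtain ⟨t, rfl⟩ := hg t
      refine ⟨Submodule.Quotient.mk (y - β t), (Submodule.Quotient.eq _).2 ⟨- t, ?_⟩⟩
      refine Prod.ext ?_ ?_
      · simp [b]
      · simpa [b] using ht
    · rintro ⟨x, hx⟩
      obtain ⟨x, rfl⟩ := Submodule.Quotient.mk_surjective _ x
      rw [← hx]
      exact (Submodule.Quotient.mk_eq_zero _).2 (Submodule.zero_mem _)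
  have eA : Function.Exact a (LinearMap.range a).mkQ := LinearMap.exact_map_mkQ_range a
  have eB : Function.Exact b (LinearMap.range b).mkQ := LinearMap.exact_map_mkQ_range b
  have eC : Function.Exact c (LinearMap.range c).mkQ := LinearMap.exact_map_mkQ_range c
  rcases n with _ | n
  · obtain ⟨qA, sA, kA⟩ := exists_connecting I J ha (Submodule.mkQ_surjective _) eA
    obtain ⟨qB, sB, kB⟩ := exists_connecting I J hb (Submodule.mkQ_surjective _) eB
    obtain ⟨qC, sC, kC⟩ := exists_connecting I J hc (Submodule.mkQ_surjective _) eC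
    refine prop_middle_of_quotients P qA qB qC sA sB (f'.restrict (map_mem_torsion I J f'))
      (g'.restrict (map_mem_torsion I J g')) ?_ ?_ ?_ ?_ hA hC
    · intro x hx
      obtain ⟨e, he, hex⟩ := (kA x).1 hx
      exact (kB _).2 ⟨LinearMap.inl R EA EC e, map_mem_torsion I J _ _ he, congrArg f' hex⟩
    · intro y hy
      obtain ⟨e, he, hey⟩ := (kB y).1 hy
      exact (kC _).2 ⟨LinearMap.snd R EA EC e, map_mem_torsion I J _ _ he, congrArg g' hey⟩
    · intro x
      exact Subtype.ext (h'.apply_apply_eq_zero _)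
    · intro y hy
      obtain ⟨e, he, hey⟩ := (kC _).1 hy
      have he' := map_mem_torsion I J ((LinearMap.range b).mkQ ∘ₗ LinearMap.inr R EA EC) e he
      have : g' (y - ((LinearMap.range b).mkQ ∘ₗ LinearMap.inr R EA EC) e) = 0 := by
        rw [map_sub, sub_eq_zero]
        exact hey.symm
      obtain ⟨x, hx⟩ := (h' _).1 this
      refine ⟨⟨x, mem_torsion_of_map_mem I J f' hf' x (hx ▸ sub_mem y.2 he')⟩, ?_⟩
      rw [← sub_eq_zero, ← map_sub, kB]
      refine ⟨- LinearMap.inr R EA EC e, neg_mem (map_mem_torsion I J _ _ he), ?_⟩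
      change _ = f' x - y
      rw [hx, map_neg]
      simp
  · rw [prop_localCohomology_shift_iff P I J ha (Submodule.mkQ_surjective _) eA] at hA
    rw [prop_localCohomology_shift_iff P I J hb (Submodule.mkQ_surjective _) eB]
    rw [prop_localCohomology_shift_iff P I J hc (Submodule.mkQ_surjective _) eC] at hC
    exact ih n (Nat.lt_succ_self n) hf' hg' h' hA hC

lemma prop_localCohomology_of_retract {X : Type u} [AddCommGroup X] [Module R X] (s : C →ₗ[R] X)
    (r : X →ₗ[R] C) (hrs : r ∘ₗ s = LinearMap.id) (i : ℕ) (hX : P (localCohomology I J i X)) :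
    P (localCohomology I J i C) := by
  let F := (torsionFunctor I J).rightDerived i
  have h : F.map (ModuleCat.ofHom s) ≫ F.map (ModuleCat.ofHom r) = 𝟙 _ := by
    rw [← F.map_comp, ← ModuleCat.ofHom_comp, hrs]
    exact F.map_id (ModuleCat.of R C)
  have : Epi (F.map (ModuleCat.ofHom r)) := SplitEpi.epi ⟨F.map (ModuleCat.ofHom s), h⟩
  have hC : P (F.obj (ModuleCat.of R C)) :=
    P.prop_of_epi (F.map (ModuleCat.ofHom r)) (show P (F.obj (ModuleCat.of R X)) from hX)
  exact hC

/-- The part `Hⁿ⁺¹(B) → Hⁿ⁺¹(C) → Hⁿ⁺²(A)` of the long exact sequence. For an embedding of `A` into an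
injective module `E` there is an exact sequence `0 → B → E × C → E ⧸ A → 0`, to which half exactness
applies; `C` is a retract of `E × C`, and the cohomology of `E ⧸ A` is that of `A` shifted by one. -/
theorem prop_localCohomology_right (n : ℕ) {A B C : Type u} [AddCommGroup A] [Module R A]
    [AddCommGroup B] [Module R B] [AddCommGroup C] [Module R C] {f : A →ₗ[R] B} {g : B →ₗ[R] C}
    (hf : Function.Injective f) (hg : Function.Surjective g) (h : Function.Exact f g)
    (hA : P (localCohomology I J (n + 2) A)) (hB : P (localCohomology I J (n + 1) B)) :
    P (localCohomology I J (n + 1) C) := by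
  obtain ⟨E, a, _, ha⟩ := exists_injective_embedding (R := R) A
  obtain ⟨β, hβ⟩ := Module.Injective.out f hf a
  rw [prop_localCohomology_shift_iff P I J ha (Submodule.mkQ_surjective _)
    (LinearMap.exact_map_mkQ_range a)] at hA
  let b : B →ₗ[R] E × C := β.prod g
  have hb : Function.Injective b := by
    rw [injective_iff_map_eq_zero]
    intro x hx
    obtain ⟨y, rfl⟩ := (h x).1 (congrArg Prod.snd hx)
    have : a y = 0 := (hβ y).symm.trans (congrArg Prod.fst hx)
    rw [ha (this.trans (map_zero a).symm), map_zero]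
  let k : (E ⧸ LinearMap.range a) →ₗ[R] ((E × C) ⧸ LinearMap.range b) :=
    Submodule.mapQ _ _ (LinearMap.inl R E C) (by
      rintro _ ⟨x, rfl⟩
      exact ⟨f x, Prod.ext (hβ x) (h.apply_apply_eq_zero x)⟩)
  have hk : Function.Bijective k := by
    constructor
    · rw [injective_iff_map_eq_zero]
      intro x hx
      obtain ⟨x, rfl⟩ := Submodule.Quotient.mk_surjective _ x
      obtain ⟨y, hy⟩ := (Submodule.Quotient.mk_eq_zero _).1 hx
      obtain ⟨z, rfl⟩ := (h y).1 (congrArg Prod.snd hy)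
      exact (Submodule.Quotient.mk_eq_zero _).2 ⟨z, (hβ z).symm.trans (congrArg Prod.fst hy)⟩
    · intro x
      obtain ⟨⟨e, c⟩, rfl⟩ := Submodule.Quotient.mk_surjective _ x
      obtain ⟨y, rfl⟩ := hg c
      refine ⟨Submodule.Quotient.mk (e - β y), (Submodule.Quotient.eq _).2 ⟨- y, ?_⟩⟩
      exact Prod.ext (by simp [b]) (by simp [b])
  refine prop_localCohomology_of_retract P I J (LinearMap.inr R E C) (LinearMap.snd R E C)
    (by ext; rfl) _
    (prop_localCohomology_middle P I J n hb (Submodule.mkQ_surjective _)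
      (LinearMap.exact_map_mkQ_range b) hB ?_)
  exact (P.prop_iff_of_iso (localCohomologyCongr I J (LinearEquiv.ofBijective k hk) (n + 1))).1 hA

end LocalCohomology

end PairLocalCohomology

/-! ### Torsion with respect to a sum of ideals and to a principal ideal -/

namespace PairLocalCohomology
variable {R : Type u} [CommRing R]

lemma W_bot (J : Ideal R) : W ⊥ J = Set.univ :=
  Set.eq_univ_of_forall fun _ => ⟨1, le_rfl, by simp⟩

lemma torsion_bot (J : Ideal R) (M : Type u) [AddCommGroup M] [Module R M] :
    torsion ⊥ J M = ⊤ :=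
  eq_top_iff.2 fun _ _ p _ => (W_bot J).symm ▸ Set.mem_univ p

lemma W_sup (I K J : Ideal R) : W (I ⊔ K) J = W I J ∩ W K J := by
  ext p
  constructor
  · rintro ⟨n, hn, h⟩
    exact ⟨⟨n, hn, (Ideal.pow_right_mono le_sup_left n).trans h⟩,
      ⟨n, hn, (Ideal.pow_right_mono le_sup_right n).trans h⟩⟩
  · rintro ⟨⟨n, hn, h⟩, ⟨m, _, h'⟩⟩
    exact ⟨n + m, by omega, Ideal.sup_pow_add_le_pow_sup_pow.trans (sup_le h h')⟩

lemma torsion_sup (I K J : Ideal R) (M : Type u) [AddCommGroup M] [Module R M] :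
    torsion (I ⊔ K) J M = torsion I J M ⊓ torsion K J M := by
  ext x
  change _ ⊆ W (I ⊔ K) J ↔ _ ⊆ W I J ∧ _ ⊆ W K J
  rw [W_sup, Set.subset_inter_iff]

/-- The multiplicative set of all `aⁿ + j` with `j ∈ J`. -/
def denominators (a : R) (J : Ideal R) : Submonoid R :=
  (Submonoid.powers (Ideal.Quotient.mk J a)).comap (Ideal.Quotient.mk J)

lemma mem_denominators {a : R} {J : Ideal R} {s : R} :
    s ∈ denominators a J ↔ ∃ n : ℕ, a ^ n - s ∈ J := by
  change (∃ n : ℕ, Ideal.Quotient.mk J a ^ n = Ideal.Quotient.mk J s) ↔ _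
  simp only [← map_pow, Ideal.Quotient.eq]

/-- `Γ_{(a), J}` is the torsion for the multiplicative set `denominators a J`: all primes containing
`Ann x + J` contain `a`, so that a power of `a` lies in `Ann x + J`. -/
lemma mem_torsion_span_singleton (a : R) (J : Ideal R) {M : Type u} [AddCommGroup M] [Module R M]
    {x : M} : x ∈ torsion (Ideal.span {a}) J M ↔ ∃ s ∈ denominators a J, s • x = 0 := by
  constructor
  · intro hx
    have hrad : a ∈ Ideal.radical (LinearMap.ker (LinearMap.toSpanSingleton R M x) ⊔ J) := by
      rw [Ideal.radical_eq_sInf, Submodule.mem_sInf]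
      rintro q ⟨hq, hqp⟩
      obtain ⟨n, -, hn⟩ := hx ((mem_support_span_singleton x ⟨q, hqp⟩).2
        fun r hr => hq (Ideal.mem_sup_left hr))
      have hn' : Ideal.span {a} ^ n ≤ q := hn.trans (sup_le le_rfl (le_sup_right.trans hq))
      exact hqp.mem_of_pow_mem n (hn' (Ideal.pow_mem_pow (Ideal.mem_span_singleton_self a) n))
    obtain ⟨n, hn⟩ := hrad
    obtain ⟨s, hs, j, hj, h⟩ := Submodule.mem_sup.1 hn
    exact ⟨s, mem_denominators.2 ⟨n, by rwa [← h, add_sub_cancel_left]⟩, hs⟩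
  · rintro ⟨s, hs, hsx⟩ p hp
    obtain ⟨n, hn⟩ := mem_denominators.1 hs
    rw [mem_support_span_singleton] at hp
    refine ⟨n + 1, by omega, ?_⟩
    rw [Ideal.span_singleton_pow, Ideal.span_singleton_le_iff_mem, pow_succ]
    refine Ideal.mul_mem_right _ _ ?_
    rw [← add_sub_cancel s (a ^ n)]
    exact Submodule.add_mem_sup (hp s hsx) hn

variable {a : R} {J : Ideal R}

lemma eq_zero_of_smul_eq_zero {M : Type u} [AddCommGroup M] [Module R M]
    (hM : torsion (Ideal.span {a}) J M = ⊥) {s : R} (hs : s ∈ denominators a J) {x : M}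
    (hx : s • x = 0) : x = 0 :=
  (Submodule.mem_bot R).1 (hM ▸ (mem_torsion_span_singleton a J).2 ⟨s, hs, hx⟩)

lemma torsion_quotient_torsion (M : Type u) [AddCommGroup M] [Module R M] :
    torsion (Ideal.span {a}) J (M ⧸ torsion (Ideal.span {a}) J M) = ⊥ := by
  rw [eq_bot_iff]
  intro x hx
  obtain ⟨x, rfl⟩ := Submodule.Quotient.mk_surjective _ x
  obtain ⟨s, hs, h⟩ := (mem_torsion_span_singleton a J).1 hx
  obtain ⟨t, ht, h'⟩ := (mem_torsion_span_singleton a J).1 ((Submodule.Quotient.mk_eq_zero _).1 h)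
  rw [Submodule.mem_bot, Submodule.Quotient.mk_eq_zero, mem_torsion_span_singleton]
  exact ⟨t * s, mul_mem ht hs, by rw [mul_smul, h']⟩

lemma torsion_torsion (I : Ideal R) (M : Type u) [AddCommGroup M] [Module R M] :
    torsion I J (torsion I J M) = ⊤ :=
  eq_top_iff.2 fun x _ => mem_torsion_of_map_mem I J (torsion I J M).subtype
    Subtype.val_injective x x.2

lemma torsion_eq_top_of_surjective (I : Ideal R) {M N : Type u} [AddCommGroup M] [Module R M]
    [AddCommGroup N] [Module R N] (f : M →ₗ[R] N) (hf : Function.Surjective f)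
    (hM : torsion I J M = ⊤) : torsion I J N = ⊤ :=
  eq_top_iff.2 fun y _ => by
    obtain ⟨x, rfl⟩ := hf y
    exact map_mem_torsion I J f x (hM ▸ Submodule.mem_top)

lemma exists_common_denominator {M : Type u} [AddCommGroup M] [Module R M] (N : Submodule R M)
    (hN : N.FG) : N ≤ torsion (Ideal.span {a}) J M → ∃ s ∈ denominators a J, ∀ x ∈ N, s • x = 0 := by
  induction N, hN using Submodule.fg_induction with
  | singleton x =>
    intro h
    obtain ⟨s, hs, hsx⟩ := (mem_torsion_span_singleton a J).1 (h (Submodule.mem_span_singleton_self x))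
    refine ⟨s, hs, fun y hy => ?_⟩
    obtain ⟨r, rfl⟩ := Submodule.mem_span_singleton.1 hy
    rw [smul_comm, hsx, smul_zero]
  | sup N₁ N₂ _ _ h₁ h₂ =>
    intro h
    obtain ⟨s, hs, hs'⟩ := h₁ (le_sup_left.trans h)
    obtain ⟨t, ht, ht'⟩ := h₂ (le_sup_right.trans h)
    refine ⟨s * t, mul_mem hs ht, fun y hy => ?_⟩
    obtain ⟨w, hw, z, hz, rfl⟩ := Submodule.mem_sup.1 hy
    rw [smul_add, mul_smul s t z, ht' z hz, mul_comm, mul_smul, hs' w hw, smul_zero, smul_zero,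
      add_zero]

/-- A torsion-free injective module is divisible by all denominators: an extension of the identity along
the injective map `x ↦ s • x` is an inverse of that map. -/
lemma exists_smul_eq_of_injective {E : Type u} [AddCommGroup E] [Module R E]
    [Module.Injective R E] (hE : torsion (Ideal.span {a}) J E = ⊥) {s : R}
    (hs : s ∈ denominators a J) (y : E) : ∃ x : E, s • x = y := by
  obtain ⟨h, hh⟩ := Module.Injective.out (LinearMap.lsmul R E s)
    ((injective_iff_map_eq_zero _).2 fun x hx => eq_zero_of_smul_eq_zero hE hs hx) LinearMap.id
  exact ⟨h y, by rw [← map_smul]; exact hh y⟩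

/-! ### Vanishing in large degrees -/

open Limits

lemma isZero_localCohomology_bot (n : ℕ) (M : Type u) [AddCommGroup M] [Module R M] :
    IsZero (localCohomology ⊥ J (n + 1) M) := by
  induction n generalizing M with
  | zero =>
    obtain ⟨E, f, _, hf⟩ := exists_injective_embedding (R := R) M
    rw [isZero_localCohomology_one_iff ⊥ J hf (Submodule.mkQ_surjective _)
      (LinearMap.exact_map_mkQ_range f)]
    intro c _
    obtain ⟨e, rfl⟩ := Submodule.mkQ_surjective _ c
    exact ⟨e, by rw [torsion_bot]; exact Submodule.mem_top, rfl⟩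
  | succ n ih =>
    obtain ⟨E, f, _, hf⟩ := exists_injective_embedding (R := R) M
    exact (prop_localCohomology_shift_iff IsZero ⊥ J hf (Submodule.mkQ_surjective _)
      (LinearMap.exact_map_mkQ_range f) n).2 (ih _)

variable [IsNoetherianRing R]

/-- Over a Noetherian ring `Γ_{(a), J}` preserves injective modules. A map `f` from an ideal `𝔟` to the
torsion is killed by a single denominator `s`. By the Artin-Rees lemma `(sᵏ⁺¹) ∩ 𝔟 ⊆ s𝔟 ⊆ ker f` for
some `k`, so `f` extends to a map on `R ⧸ (sᵏ⁺¹)`, whose image is again torsion. -/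
instance injective_torsion (E : Type u) [AddCommGroup E] [Module R E] [Module.Injective R E] :
    Module.Injective R (torsion (Ideal.span {a}) J E) := by
  refine Module.Baer.injective fun 𝔟 f => ?_
  let T := torsion (Ideal.span {a}) J E
  obtain ⟨s, hs, hsf⟩ := exists_common_denominator (a := a) (J := J)
    (LinearMap.range (T.subtype ∘ₗ f)) (by rw [LinearMap.range_eq_map]; exact Module.Finite.fg_top.map _)
    (by rintro _ ⟨x, rfl⟩; exact (f x).2)
  obtain ⟨k, hk⟩ := Ideal.exists_pow_inf_eq_pow_smul (Ideal.span {s}) 𝔟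
  let φ : 𝔟 →ₗ[R] R ⧸ Ideal.span {s ^ (k + 1)} := (Ideal.span {s ^ (k + 1)}).mkQ ∘ₗ 𝔟.subtype
  have hφ : LinearMap.ker φ ≤ LinearMap.ker (T.subtype ∘ₗ f) := by
    intro x hx
    have hx' : (x : R) ∈ Ideal.span {s ^ (k + 1)} := (Submodule.Quotient.mk_eq_zero _).1 hx
    have hx2 : (x : R) ∈ Ideal.span {s} ^ (k + 1) • (⊤ : Submodule R R) ⊓ 𝔟 := by
      refine ⟨?_, x.2⟩
      simpa [Ideal.span_singleton_pow] using hx'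
    rw [hk (k + 1) (Nat.le_succ k), Nat.add_sub_cancel_left, pow_one,
      Submodule.ideal_span_singleton_smul] at hx2
    obtain ⟨y, hy, hyx⟩ := hx2
    have : x = s • (⟨y, hy.2⟩ : 𝔟) := Subtype.ext hyx.symm
    rw [LinearMap.mem_ker, this, map_smul]
    exact hsf _ ⟨_, rfl⟩
  obtain ⟨h, hh⟩ := Module.Injective.out ((LinearMap.ker φ).liftQ φ le_rfl)
    (LinearMap.ker_eq_bot.1 (Submodule.ker_liftQ_eq_bot' _ φ rfl))
    ((LinearMap.ker φ).liftQ (T.subtype ∘ₗ f) hφ)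
  refine ⟨(h ∘ₗ (Ideal.span {s ^ (k + 1)}).mkQ).codRestrict T fun r => ?_, fun x hx => ?_⟩
  · refine (mem_torsion_span_singleton a J).2 ⟨s ^ (k + 1), pow_mem hs _, ?_⟩
    rw [← map_smul]
    have : s ^ (k + 1) • r ∈ Ideal.span {s ^ (k + 1)} :=
      Ideal.mul_mem_right _ _ (Ideal.mem_span_singleton_self _)
    rw [LinearMap.comp_apply, Submodule.mkQ_apply, (Submodule.Quotient.mk_eq_zero _).2 this,
      map_zero]
  · exact Subtype.ext (hh (Submodule.Quotient.mk ⟨x, hx⟩))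

/-- The torsion submodule of an injective module is a direct summand, hence so is the quotient. -/
instance injective_quotient_torsion (E : Type u) [AddCommGroup E] [Module R E]
    [Module.Injective R E] : Module.Injective R (E ⧸ torsion (Ideal.span {a}) J E) where
  out X Y _ _ _ _ i hi f := by
    let T := torsion (Ideal.span {a}) J E
    obtain ⟨r, hr⟩ := Module.Injective.out T.subtype Subtype.val_injective LinearMap.id
    let σ : (E ⧸ T) →ₗ[R] E := T.liftQ (LinearMap.id - T.subtype ∘ₗ r) (fun x hx => by
      have : r x = ⟨x, hx⟩ := hr ⟨x, hx⟩
      simp [this])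
    have hσ : ∀ q, T.mkQ (σ q) = q := fun q => by
      obtain ⟨x, rfl⟩ := Submodule.Quotient.mk_surjective _ q
      refine (Submodule.Quotient.eq _).2 ?_
      have : σ (Submodule.Quotient.mk x) = x - r x := rfl
      rw [this, sub_sub_cancel_left]
      exact neg_mem (r x).2
    obtain ⟨h, hh⟩ := Module.Injective.out i hi (σ ∘ₗ f)
    exact ⟨T.mkQ ∘ₗ h, fun x => by rw [LinearMap.comp_apply, hh, LinearMap.comp_apply, hσ]⟩

lemma exists_torsionFree_injective_embedding (M : Type u) [AddCommGroup M] [Module R M]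
    (hM : torsion (Ideal.span {a}) J M = ⊥) :
    ∃ (E : ModuleCat.{u} R) (f : M →ₗ[R] E), Module.Injective R E ∧ Function.Injective f ∧
      torsion (Ideal.span {a}) J E = ⊥ := by
  obtain ⟨E, f, _, hf⟩ := exists_injective_embedding (R := R) M
  refine ⟨ModuleCat.of R (E ⧸ torsion (Ideal.span {a}) J E), Submodule.mkQ _ ∘ₗ f,
    injective_quotient_torsion _, ?_, torsion_quotient_torsion _⟩
  rw [injective_iff_map_eq_zero]
  intro x hx
  have := mem_torsion_of_map_mem _ _ f hf x ((Submodule.Quotient.mk_eq_zero _).1 hx)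
  rwa [hM, Submodule.mem_bot] at this


variable (I : Ideal R)

/-- A module that is torsion for `(a)` embeds into a torsion injective module with torsion cokernel, and
on such modules `Γ_{I + (a), J}` and `Γ_{I, J}` agree. -/
lemma isZero_localCohomology_sup_of_torsion (n : ℕ) (M : Type u) [AddCommGroup M] [Module R M]
    (hM : torsion (Ideal.span {a}) J M = ⊤) (h : IsZero (localCohomology I J (n + 1) M)) :
    IsZero (localCohomology (I ⊔ Ideal.span {a}) J (n + 1) M) := by
  induction n using Nat.strong_induction_on generalizing M with
  | _ n ih =>
  obtain ⟨E₀, f₀, _, hf₀⟩ := exists_injective_embedding (R := R) M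
  let E := torsion (Ideal.span {a}) J E₀
  let f : M →ₗ[R] E := f₀.codRestrict _ fun x => map_mem_torsion _ _ f₀ x (hM ▸ Submodule.mem_top)
  have hf : Function.Injective f := fun x y hxy => hf₀ congr(($hxy).1)
  have hE : torsion (Ideal.span {a}) J E = ⊤ := torsion_torsion _ _
  have hC : torsion (Ideal.span {a}) J (E ⧸ LinearMap.range f) = ⊤ :=
    torsion_eq_top_of_surjective _ _ (Submodule.mkQ_surjective _) hE
  have hex := LinearMap.exact_map_mkQ_range f
  rcases n with _ | n
  · have h' := (isZero_localCohomology_one_iff I J hf (Submodule.mkQ_surjective _) hex).1 h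
    refine (isZero_localCohomology_one_iff _ J hf (Submodule.mkQ_surjective _) hex).2 ?_
    simpa only [torsion_sup, hE, hC, inf_top_eq] using h'
  · have h' := (prop_localCohomology_shift_iff IsZero I J hf
      (Submodule.mkQ_surjective _) hex n).1 h
    exact (prop_localCohomology_shift_iff IsZero _ J hf (Submodule.mkQ_surjective _) hex n).2
      (ih n (Nat.lt_succ_self n) _ hC h')

/-- The hypotheses say that all denominators act bijectively. Such a module embeds into an injective
module of the same kind, the cokernel is again of this kind, and `Γ_{I + (a), J}` is zero on it. -/
lemma isZero_localCohomology_sup_of_bijective (n : ℕ) (M : Type u) [AddCommGroup M] [Module R M]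
    (hM : torsion (Ideal.span {a}) J M = ⊥)
    (hd : ∀ s ∈ denominators a J, ∀ y : M, ∃ x : M, s • x = y) :
    IsZero (localCohomology (I ⊔ Ideal.span {a}) J (n + 1) M) := by
  induction n using Nat.strong_induction_on generalizing M with
  | _ n ih =>
  obtain ⟨E, f, _, hf, hE⟩ := exists_torsionFree_injective_embedding M hM
  have hex := LinearMap.exact_map_mkQ_range f
  have hC : torsion (Ideal.span {a}) J (E ⧸ LinearMap.range f) = ⊥ := by
    rw [eq_bot_iff]
    intro c hc
    obtain ⟨e, rfl⟩ := Submodule.Quotient.mk_surjective _ c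
    obtain ⟨s, hs, hse⟩ := (mem_torsion_span_singleton a J).1 hc
    obtain ⟨y, hy⟩ := (Submodule.Quotient.mk_eq_zero _).1 hse
    obtain ⟨x, rfl⟩ := hd s hs y
    rw [map_smul] at hy
    have : f x - e = 0 := eq_zero_of_smul_eq_zero hE hs (by rw [smul_sub, hy, sub_self])
    exact (Submodule.Quotient.mk_eq_zero _).2 ⟨x, sub_eq_zero.1 this⟩
  rcases n with _ | n
  · refine (isZero_localCohomology_one_iff _ J hf (Submodule.mkQ_surjective _) hex).2 ?_
    intro c hc
    rw [torsion_sup, hC, inf_bot_eq, Submodule.mem_bot] at hc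
    exact ⟨0, Submodule.zero_mem _, by rw [hc, map_zero]⟩
  · refine (prop_localCohomology_shift_iff IsZero _ J hf (Submodule.mkQ_surjective _) hex n).2
      (ih n (Nat.lt_succ_self n) _ hC fun s hs y => ?_)
    obtain ⟨e, rfl⟩ := Submodule.Quotient.mk_surjective _ y
    obtain ⟨x, rfl⟩ := exists_smul_eq_of_injective hE hs e
    exact ⟨Submodule.Quotient.mk x, rfl⟩

/-- Adding one generator to `I` raises the vanishing bound by at most one. The torsion part of `M` is
covered by `isZero_localCohomology_sup_of_torsion`. The torsion-free part embeds into a torsion-free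
injective module `E`; its cokernel `C` is divisible, so on `C` modulo torsion the denominators act
bijectively, and the degree has dropped by one. -/
lemma isZero_localCohomology_sup_span_singleton (s : ℕ)
    (h : ∀ n, s ≤ n → ∀ (M : Type u) [AddCommGroup M] [Module R M],
      IsZero (localCohomology I J (n + 1) M)) (n : ℕ) (hn : s ≤ n) (M : Type u)
    [AddCommGroup M] [Module R M] :
    IsZero (localCohomology (I ⊔ Ideal.span {a}) J (n + 2) M) := by
  let T := torsion (Ideal.span {a}) J M
  refine prop_localCohomology_middle IsZero _ J (n + 1) T.subtype_injective T.mkQ_surjective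
    (LinearMap.exact_subtype_mkQ T)
    (isZero_localCohomology_sup_of_torsion I (n + 1) T (torsion_torsion _ _) (h _ (by omega) _)) ?_
  have hMT : torsion (Ideal.span {a}) J (M ⧸ T) = ⊥ := torsion_quotient_torsion M
  obtain ⟨E, f, _, hf, hE⟩ := exists_torsionFree_injective_embedding _ hMT
  refine (prop_localCohomology_shift_iff IsZero _ J hf (Submodule.mkQ_surjective _)
    (LinearMap.exact_map_mkQ_range f) n).2 ?_
  let T' := torsion (Ideal.span {a}) J (E ⧸ LinearMap.range f)
  refine prop_localCohomology_middle IsZero _ J n T'.subtype_injective T'.mkQ_surjective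
    (LinearMap.exact_subtype_mkQ T')
    (isZero_localCohomology_sup_of_torsion I n T' (torsion_torsion _ _) (h _ hn _))
    (isZero_localCohomology_sup_of_bijective I n _ (torsion_quotient_torsion _) fun s hs y => ?_)
  obtain ⟨y, rfl⟩ := Submodule.Quotient.mk_surjective _ y
  obtain ⟨y, rfl⟩ := Submodule.Quotient.mk_surjective _ y
  obtain ⟨x, rfl⟩ := exists_smul_eq_of_injective hE hs y
  exact ⟨Submodule.Quotient.mk (Submodule.Quotient.mk x), rfl⟩

/-- The local cohomology functors for `(I, J)` vanish above some degree, uniformly in the module. -/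
theorem exists_forall_isZero_localCohomology (I J : Ideal R) :
    ∃ s : ℕ, ∀ n, s ≤ n → ∀ (M : Type u) [AddCommGroup M] [Module R M],
      IsZero (localCohomology I J (n + 1) M) := by
  classical
  obtain ⟨t, rfl⟩ := IsNoetherian.noetherian I
  induction t using Finset.induction_on with
  | empty =>
    refine ⟨0, fun n _ M _ _ => ?_⟩
    rw [Finset.coe_empty, Submodule.span_empty]
    exact isZero_localCohomology_bot n M
  | insert a t _ ih =>
    obtain ⟨s, hs⟩ := ih
    refine ⟨s + 1, fun n hn M _ _ => ?_⟩
    obtain ⟨n, rfl⟩ := Nat.exists_eq_add_of_le' hn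
    rw [Finset.coe_insert, Submodule.span_insert, sup_comm]
    exact isZero_localCohomology_sup_span_singleton _ s hs (n + s) (by omega) M

end PairLocalCohomology

/-! ### Maps to quotients by primes in the support -/

namespace PairLocalCohomology
variable {R : Type u} [CommRing R]

open TensorProduct in
lemma exists_ne_zero_toResidueField {M : Type u} [AddCommGroup M] [Module R M] [Module.Finite R M]
    {p : PrimeSpectrum R} (hp : p ∈ Module.support R M) :
    ∃ ψ : M →ₗ[R] p.asIdeal.ResidueField, ψ ≠ 0 := by
  let K := p.asIdeal.ResidueField
  have : Nontrivial (K ⊗[R] M) :=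
    (Module.mem_support_iff_nontrivial_residueField_tensorProduct p).1 hp
  obtain ⟨v, hv⟩ := exists_ne (0 : K ⊗[R] M)
  obtain ⟨φ, hφ⟩ := not_forall.1 (mt (Module.forall_dual_apply_eq_zero_iff K v).1 hv)
  refine ⟨φ.restrictScalars R ∘ₗ TensorProduct.mk R K M 1, fun h => hφ ?_⟩
  have h' (m : M) : φ (1 ⊗ₜ m) = 0 := congr($h m)
  suffices φ = 0 by rw [this, LinearMap.zero_apply]
  ext m
  simpa using h' m

lemma mem_support_quotient_iff {p : Ideal R} {q : PrimeSpectrum R} :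
    q ∈ Module.support R (R ⧸ p) ↔ p ≤ q.asIdeal := by
  rw [Module.mem_support_iff_of_finite, Ideal.annihilator_quotient]

/-- A finitely generated module has a non-zero map to `R ⧸ 𝔭` for each `𝔭` in its support: clear
denominators in a non-zero map to the residue field. -/
lemma exists_ne_zero_toQuotient {M : Type u} [AddCommGroup M] [Module R M] [Module.Finite R M]
    {p : PrimeSpectrum R} (hp : p ∈ Module.support R M) :
    ∃ θ : M →ₗ[R] R ⧸ p.asIdeal, θ ≠ 0 := by
  obtain ⟨ψ, hψ⟩ := exists_ne_zero_toResidueField hp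
  obtain ⟨t, ht⟩ := (Module.Finite.fg_top : (⊤ : Submodule R M).FG)
  obtain ⟨b, hb⟩ := IsLocalization.exist_integer_multiples (nonZeroDivisors (R ⧸ p.asIdeal)) t ψ
  obtain ⟨r, hr⟩ := Ideal.Quotient.mk_surjective (b : R ⧸ p.asIdeal)
  let ι : (R ⧸ p.asIdeal) →ₗ[R] p.asIdeal.ResidueField :=
    (IsScalarTower.toAlgHom R (R ⧸ p.asIdeal) p.asIdeal.ResidueField).toLinearMap
  have hι : Function.Injective ι :=
    IsFractionRing.injective (R ⧸ p.asIdeal) p.asIdeal.ResidueField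
  have hsm (x : p.asIdeal.ResidueField) : (b : R ⧸ p.asIdeal) • x = r • x := by
    rw [← hr]; exact algebraMap_smul (R ⧸ p.asIdeal) r x
  have hrange (m : M) : (r • ψ) m ∈ LinearMap.range ι := by
    have : (⊤ : Submodule R M) ≤ (LinearMap.range ι).comap (r • ψ) := by
      rw [← ht, Submodule.span_le]
      intro m hm
      obtain ⟨x, hx⟩ := hb m hm
      exact ⟨x, hx.trans (hsm _)⟩
    exact this Submodule.mem_top
  refine ⟨(LinearEquiv.ofInjective ι hι).symm.toLinearMap ∘ₗ (r • ψ).codRestrict _ hrange,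
    fun h => hψ ?_⟩
  ext m
  have h1 : (LinearEquiv.ofInjective ι hι).symm ((r • ψ).codRestrict _ hrange m) = 0 := congr($h m)
  rw [LinearEquiv.map_eq_zero_iff] at h1
  have h2 : r • ψ m = 0 := congrArg Subtype.val h1
  rw [← hsm] at h2
  exact (smul_eq_zero.1 h2).resolve_left (nonZeroDivisors.coe_ne_zero b)

lemma exists_minimalPrimes_annihilator_le {M : Type u} [AddCommGroup M] [Module R M]
    [Module.Finite R M] {q : PrimeSpectrum R} (hq : q ∈ Module.support R M) :
    ∃ p : PrimeSpectrum R, p.asIdeal ∈ (Module.annihilator R M).minimalPrimes ∧ p ≤ q := by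
  obtain ⟨p, hp, hpq⟩ := Ideal.exists_minimalPrimes_le (Module.mem_support_iff_of_finite.1 hq)
  exact ⟨⟨p, hp.1.1⟩, hp, hpq⟩

/-! ### Suprema of cohomological dimensions -/

lemma le_serreCD (P : ObjectProperty (ModuleCat.{u} R)) (I J : Ideal R) (M : Type u)
    [AddCommGroup M] [Module R M] {i : ℕ} (hi : ¬ P (localCohomology I J i M)) :
    (i : ℕ∞) ≤ serreCD P I J M :=
  le_sSup ⟨i, rfl, hi⟩

lemma serreCD_le_iff (P : ObjectProperty (ModuleCat.{u} R)) (I J : Ideal R) (M : Type u)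
    [AddCommGroup M] [Module R M] (t : ℕ) :
    serreCD P I J M ≤ t ↔ ∀ n, t ≤ n → P (localCohomology I J (n + 1) M) := by
  rw [serreCD, sSup_le_iff]
  constructor
  · intro h n hn
    by_contra hP
    have := h _ ⟨n + 1, rfl, hP⟩
    norm_cast at this
    omega
  · rintro h _ ⟨i, rfl, hi⟩
    by_contra hlt
    push Not at hlt
    norm_cast at hlt
    obtain ⟨n, rfl⟩ : ∃ n, i = n + 1 := ⟨i - 1, by omega⟩
    exact hi (h n (by omega))

/-- A finite upper bound that is least among the finite upper bounds is attained, as `ℕ` is discrete. -/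
lemma isMaxOrZero_of_forall {A : Set ℕ∞} {a : ℕ} (h₁ : ∀ k ∈ A, k ≤ a)
    (h₂ : ∀ t : ℕ, (∀ k ∈ A, k ≤ t) → a ≤ t) : IsMaxOrZero A a := by
  refine ⟨⟨h₁, fun b hb => ?_⟩, fun ⟨k, hk⟩ => ?_⟩
  · induction b using ENat.recTopCoe with
    | top => exact le_top
    | coe t => exact_mod_cast h₂ t fun k hk => hb hk
  · by_contra ha
    rcases a with _ | a
    · exact ha (by rwa [← le_antisymm (h₁ k hk) (by simp)])
    · have := h₂ a fun k hk => Order.le_of_lt_add_one <| by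
        have := lt_of_le_of_ne (h₁ k hk) (fun h => ha (h ▸ hk))
        exact_mod_cast this
      omega

/-! ### Comparison of modules by their support -/

variable [IsNoetherianRing R] (P : ObjectProperty (ModuleCat.{u} R)) [P.IsSerreClass] (I J : Ideal R)

/-- Membership of local cohomology in a Serre class can be checked on a prime filtration. -/
lemma prop_localCohomology_of_primes (n : ℕ) (X : Set (PrimeSpectrum R))
    (hX : ∀ p ∈ X, P (localCohomology I J (n + 1) (R ⧸ p.asIdeal))) (N : Type u) [AddCommGroup N]
    [Module R N] [hN : Module.Finite R N] (hNX : Module.support R N ⊆ X) :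
    P (localCohomology I J (n + 1) N) := by
  induction hN using IsNoetherianRing.induction_on_isQuotientEquivQuotientPrime R with
  | subsingleton N =>
    have : Module.Injective R N := ⟨fun _ _ _ _ _ _ _ _ _ => ⟨0, fun _ => Subsingleton.elim _ _⟩⟩
    exact prop_localCohomology_injective P I J N n
  | quotient N p e =>
    refine (P.prop_iff_of_iso (localCohomologyCongr I J e (n + 1))).2 (hX p (hNX ?_))
    rw [e.support_eq, mem_support_quotient_iff]
  | exact N₁ N₂ N₃ f g hf hg h ih₁ ih₃ =>
    rw [Module.support_of_exact h hf hg] at hNX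
    exact prop_localCohomology_middle P I J n hf hg h
      (ih₁ (Set.subset_union_left.trans hNX)) (ih₃ (Set.subset_union_right.trans hNX))

/-- If the local cohomology of `M` lies in a Serre class in all degrees above `t`, then so does that of
each finitely generated `N` with `Supp N ⊆ Supp M`. -/
theorem prop_localCohomology_of_support_subset {M : Type u} [AddCommGroup M] [Module R M]
    [Module.Finite R M] (t : ℕ) (hM : ∀ n, t ≤ n → P (localCohomology I J (n + 1) M))
    (n : ℕ) (hn : t ≤ n) (N : Type u) [AddCommGroup N] [Module R N] [Module.Finite R N]
    (hNM : Module.support R N ⊆ Module.support R M) : P (localCohomology I J (n + 1) N) := by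
  obtain ⟨s, hs⟩ := exists_forall_isZero_localCohomology I J
  -- `d` measures how far `n` is below the bound `s`; all cohomology vanishes from degree `s + 1` on.
  obtain ⟨d, hd⟩ : ∃ d, s ≤ n + d := ⟨s, Nat.le_add_left s n⟩
  induction d generalizing n N with
  | zero => exact P.prop_of_isZero (hs n hd N)
  | succ d ih =>
    refine prop_localCohomology_of_primes P I J n (Module.support R M) (fun p hp => ?_) N hNM
    induction p using (InvImage.wf PrimeSpectrum.asIdeal (wellFounded_gt (α := Ideal R))).induction
      with
    | _ p ihp =>
    obtain ⟨θ, hθ⟩ := exists_ne_zero_toQuotient hp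
    have hsub : Module.support R (R ⧸ p.asIdeal) ⊆ Module.support R M :=
      fun q hq => Module.mem_support_mono (mem_support_quotient_iff.1 hq) hp
    have hrange : P (localCohomology I J (n + 1) (LinearMap.range θ)) :=
      prop_localCohomology_right P I J n (LinearMap.ker θ).subtype_injective
        θ.surjective_rangeRestrict
        (fun x => by simp [← LinearMap.mem_ker])
        (ih (n + 1) (by omega) _
          (Module.support_subset_of_injective _ (LinearMap.ker θ).subtype_injective) (by omega))
        (hM n hn)
    refine prop_localCohomology_middle P I J n (LinearMap.range θ).subtype_injective
      (LinearMap.range θ).mkQ_surjective (LinearMap.exact_subtype_mkQ _) hrange ?_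
    refine prop_localCohomology_of_primes P I J n {q | q ∈ Module.support R M ∧ p.asIdeal < q.asIdeal}
      (fun q hq => ihp q hq.2 hq.1) _ fun q hq => ?_
    have hq' := Module.support_subset_of_surjective _ (LinearMap.range θ).mkQ_surjective hq
    refine ⟨hsub hq', lt_of_le_of_ne (mem_support_quotient_iff.1 hq') ?_⟩
    · intro hpq
      -- A lift `r` of a non-zero value of `θ` kills the cokernel of `θ` and is not in `p`.
      obtain ⟨m, hm⟩ := DFunLike.ne_iff.1 hθ
      obtain ⟨r, hr⟩ := Ideal.Quotient.mk_surjective (θ m)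
      rw [Module.mem_support_iff_of_finite] at hq
      have hrq : r ∈ q.asIdeal := hq (Module.mem_annihilator.2 fun y => by
        obtain ⟨y, rfl⟩ := Submodule.Quotient.mk_surjective _ y
        obtain ⟨y, rfl⟩ := Ideal.Quotient.mk_surjective y
        refine (Submodule.Quotient.mk_eq_zero _).2 ⟨y • m, ?_⟩
        rw [map_smul, ← hr]
        simp [Algebra.smul_def, mul_comm])
      rw [← hpq, ← Ideal.Quotient.eq_zero_iff_mem, hr] at hrq
      exact hm hrq

lemma exists_serreCD_eq (M : Type u) [AddCommGroup M] [Module R M] :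
    ∃ t : ℕ, serreCD P I J M = t := by
  obtain ⟨s, hs⟩ := exists_forall_isZero_localCohomology I J
  have h : serreCD P I J M ≤ s :=
    (serreCD_le_iff P I J M s).2 fun n hn => P.prop_of_isZero (hs n hn M)
  obtain ⟨t, ht⟩ := ENat.ne_top_iff_exists.1 (ne_top_of_le_ne_top (ENat.natCast_ne_top s) h)
  exact ⟨t, ht.symm⟩

theorem serreCD_mono {M N : Type u} [AddCommGroup M] [Module R M] [Module.Finite R M]
    [AddCommGroup N] [Module R N] [Module.Finite R N]
    (h : Module.support R N ⊆ Module.support R M) : serreCD P I J N ≤ serreCD P I J M := by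
  obtain ⟨t, ht⟩ := exists_serreCD_eq P I J M
  rw [ht, serreCD_le_iff]
  intro n hn
  exact prop_localCohomology_of_support_subset P I J t
    ((serreCD_le_iff P I J M t).1 ht.le) n hn N h

variable {M : Type u} [AddCommGroup M] [Module R M] [Module.Finite R M]

lemma serreCD_quotient_le {p : Ideal R} (hp : Module.annihilator R M ≤ p) :
    serreCD P I J (R ⧸ p) ≤ serreCD P I J M :=
  serreCD_mono P I J fun _ hq =>
    Module.mem_support_iff_of_finite.2 (hp.trans (mem_support_quotient_iff.1 hq))

lemma serreCD_le_of_primes {X : Set (PrimeSpectrum R)}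
    (hX : {p | p.asIdeal ∈ (Module.annihilator R M).minimalPrimes} ⊆ X) (t : ℕ)
    (h : ∀ p ∈ X, serreCD P I J (R ⧸ p.asIdeal) ≤ t) : serreCD P I J M ≤ t := by
  rw [serreCD_le_iff]
  intro n hn
  refine prop_localCohomology_of_primes P I J n (Module.support R M) (fun q hq => ?_) M le_rfl
  obtain ⟨p, hp, hpq⟩ := exists_minimalPrimes_annihilator_le hq
  have hq' : serreCD P I J (R ⧸ q.asIdeal) ≤ serreCD P I J (R ⧸ p.asIdeal) :=
    serreCD_quotient_le P I J (by rwa [Ideal.annihilator_quotient])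
  exact (serreCD_le_iff P I J _ t).1 (hq'.trans (h p (hX hp))) n hn

/-- The maximum may be taken over any set of primes between the minimal primes of `M` and its support. -/
lemma isMaxOrZero_serreCD {X : Set (PrimeSpectrum R)} (hXM : X ⊆ Module.support R M)
    (hX : {p | p.asIdeal ∈ (Module.annihilator R M).minimalPrimes} ⊆ X) :
    IsMaxOrZero {k | ∃ p ∈ X, k = serreCD P I J (R ⧸ p.asIdeal)} (serreCD P I J M) := by
  obtain ⟨a, ha⟩ := exists_serreCD_eq P I J M
  rw [ha]
  refine isMaxOrZero_of_forall ?_ fun t ht => ?_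
  · rintro _ ⟨p, hp, rfl⟩
    exact ha ▸ serreCD_quotient_le P I J (Module.mem_support_iff_of_finite.1 (hXM hp))
  · have := serreCD_le_of_primes P I J hX t fun p hp => ht _ ⟨p, hp, rfl⟩
    rw [ha] at this
    exact_mod_cast this

end PairLocalCohomology

theorem corollary4p20 {R : Type u} [CommRing R] [IsNoetherianRing R]
    (S : ObjectProperty (ModuleCat.{u} R)) [S.IsSerreClass] (I J : Ideal R)
    (M : Type u) [AddCommGroup M] [Module R M] [Module.Finite R M] :
    PairLocalCohomology.IsMaxOrZero
      {k | ∃ p ∈ associatedPrimes R M, k = PairLocalCohomology.serreCD S I J (R ⧸ p)}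
      (PairLocalCohomology.serreCD S I J M) ∧
    PairLocalCohomology.IsMaxOrZero
      {k | ∃ p, Minimal (fun q => q ∈ associatedPrimes R M) p ∧
        k = PairLocalCohomology.serreCD S I J (R ⧸ p)}
      (PairLocalCohomology.serreCD S I J M) ∧
    PairLocalCohomology.IsMaxOrZero
      {k | ∃ p ∈ Module.support R M, k = PairLocalCohomology.serreCD S I J (R ⧸ p.asIdeal)}
      (PairLocalCohomology.serreCD S I J M) ∧
    PairLocalCohomology.IsMaxOrZero
      {k | ∃ p, Minimal (fun q => q ∈ Module.support R M) p ∧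
        k = PairLocalCohomology.serreCD S I J (R ⧸ p.asIdeal)}
      (PairLocalCohomology.serreCD S I J M) ∧
    PairLocalCohomology.IsMaxOrZero
      {k | ∃ N : Submodule R M, Module.Finite R N ∧ k = PairLocalCohomology.serreCD S I J N}
      (PairLocalCohomology.serreCD S I J M) ∧
    PairLocalCohomology.IsMaxOrZero
      {k | ∃ i : ℕ, k = i ∧ ∃ p ∈ associatedPrimes R M,
        ¬ S (PairLocalCohomology.localCohomology I J i (R ⧸ p))}
      (PairLocalCohomology.serreCD S I J M) ∧
    IsLeast
      {k : ℕ∞ | ∃ n : ℕ, k = n ∧ ∀ i : ℕ, n < i → ∀ p ∈ associatedPrimes R M,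
        S (PairLocalCohomology.localCohomology I J i (R ⧸ p))}
      (PairLocalCohomology.serreCD S I J M) := by
  open PairLocalCohomology in
  have hAnn {p : Ideal R} (hp : p ∈ (Module.annihilator R M).minimalPrimes) :
      p ∈ associatedPrimes R M :=
    Module.associatedPrimes.minimalPrimes_annihilator_subset_associatedPrimes R M hp
  have hle {p : Ideal R} (hp : p ∈ associatedPrimes R M) : Module.annihilator R M ≤ p := by
    rw [← Submodule.annihilator_top]
    exact IsAssociatedPrime.annihilator_le hp
  have hsupp {p : Ideal R} (hp : p ∈ associatedPrimes R M) :
      (⟨p, hp.isPrime⟩ : PrimeSpectrum R) ∈ Module.support R M :=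
    Module.mem_support_iff_of_finite.2 (hle hp)
  have hAss (t : ℕ) (h : ∀ p ∈ associatedPrimes R M, serreCD S I J (R ⧸ p) ≤ t) :
      serreCD S I J M ≤ t :=
    serreCD_le_of_primes S I J (X := {p | p.asIdeal ∈ associatedPrimes R M})
      (fun p hp => hAnn hp) t fun p hp => h _ hp
  obtain ⟨a, ha⟩ := exists_serreCD_eq S I J M
  refine ⟨?_, ?_, ?_, ?_, ?_, ?_, ?_⟩
  · convert isMaxOrZero_serreCD S I J (M := M) (X := {p | p.asIdeal ∈ associatedPrimes R M})
      (fun p hp => hsupp hp) (fun p hp => hAnn hp) using 2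
    ext k
    exact ⟨fun ⟨p, hp, hk⟩ => ⟨⟨p, hp.isPrime⟩, hp, hk⟩, fun ⟨p, hp, hk⟩ => ⟨_, hp, hk⟩⟩
  · convert isMaxOrZero_serreCD S I J (M := M)
      (X := {p | Minimal (fun q => q ∈ associatedPrimes R M) p.asIdeal})
      (fun p hp => hsupp hp.1)
      (fun p hp => ⟨hAnn hp, fun q hq hqp => hp.2 ⟨hq.isPrime, hle hq⟩ hqp⟩) using 2
    ext k
    exact ⟨fun ⟨p, hp, hk⟩ => ⟨⟨p, hp.1.isPrime⟩, hp, hk⟩, fun ⟨p, hp, hk⟩ => ⟨_, hp, hk⟩⟩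
  · exact isMaxOrZero_serreCD S I J le_rfl fun p hp => hsupp (hAnn hp)
  · exact isMaxOrZero_serreCD S I J (X := {p | Minimal (fun q => q ∈ Module.support R M) p})
      (fun p hp => hp.1)
      fun p hp => ⟨hsupp (hAnn hp), fun q hq hqp =>
        hp.2 ⟨q.2, Module.mem_support_iff_of_finite.1 hq⟩ hqp⟩
  · have htop : serreCD S I J M = serreCD S I J (⊤ : Submodule R M) :=
      le_antisymm (serreCD_mono S I J (LinearEquiv.support_eq Submodule.topEquiv).ge)
        (serreCD_mono S I J (LinearEquiv.support_eq Submodule.topEquiv).le)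
    have hmem : serreCD S I J M ∈ {k | ∃ N : Submodule R M, Module.Finite R N ∧
        k = serreCD S I J N} := ⟨⊤, inferInstance, htop⟩
    refine ⟨⟨?_, fun b hb => hb hmem⟩, fun _ => hmem⟩
    rintro _ ⟨N, _, rfl⟩
    exact serreCD_mono S I J (Module.support_subset_of_injective _ N.subtype_injective)
  · rw [ha]
    refine isMaxOrZero_of_forall ?_ fun t ht => ?_
    · rintro _ ⟨i, rfl, p, hp, hi⟩
      rw [← ha]
      exact (le_serreCD S I J (R ⧸ p) hi).trans (serreCD_quotient_le S I J (hle hp))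
    · have := hAss t fun p hp => (serreCD_le_iff S I J _ t).2 fun n hn => by
        by_contra hi
        have := ht _ ⟨n + 1, rfl, p, hp, hi⟩
        norm_cast at this
        omega
      rw [ha] at this
      exact_mod_cast this
  · refine ⟨⟨a, ha, fun i hi p hp => ?_⟩, ?_⟩
    · obtain ⟨n, rfl⟩ : ∃ n, i = n + 1 := ⟨i - 1, by omega⟩
      exact (serreCD_le_iff S I J _ a).1 (ha ▸ serreCD_quotient_le S I J (hle hp)) n (by omega)
    · rintro _ ⟨n, rfl, h⟩
      exact hAss n fun p hp => (serreCD_le_iff S I J _ n).2 fun i hi => h (i + 1) (by omega) p hp
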